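/- Let $n\ge 2$ and let $S^{n-1}\subset\mathbb{R}^n$ be the unit sphere. For $t\ge 0$ let $C_t^{\lambda}$ be the Gegenbauer polynomial of degree $t$, i.e. $(1-2xr+r^2)^{-\lambda}=\sum_{t\ge 0}C_t^{\lambda}(x)r^t$ for small $|r|$ if $\lambda\neq 0$, and $C_t^0=T_t$, the Chebyshev polynomial of the first kind. Put $d_{n,t}=\binom{n+t-1}{t}-\binom{n+t-3}{t-2}$ (a binomial coefficient with negative lower index is $0$), let $Q_{n,t}$ be the scalar multiple of $C_t^{(n-2)/2}$ with $Q_{n,t}(1)=d_{n,t}$, and put $$c_{n,t}=-\min_{-1\le x\le 1}Q_{n,t}(x),\qquad b_{n,t}=1+\frac{d_{n,t}}{c_{n,t}}.$$ A finite nonempty set $X\subset S^{n-1}$ is a harmonic index $t$-design if $\sum_{x\in X}f(x)=0$ for every real homogeneous polynomial $f$ of degree $t$ in $n$ variables with $\sum_{i}\partial^2 f/\partial x_i^2=0$. For finite $X\subset S^{n-1}$ put $I(X)=\{\langle x,y\rangle : x,y\in X,\ x\neq y\}$. Then $$b_{n,4}=\frac{(n+1)(n+2)}{6}.$$ In particular,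 $b_{n,4}$ is an integer if and only if $3\nmid n$. Furthermore, in that case, for every finite set $X\subset S^{n-1}$ with $|X|=b_{n,4}$ the following are equivalent: 1. $X$ is a harmonic index $4$-design; 2. $I(X)\subset\left\{\pm\sqrt{\tfrac{3}{n+4}}\right\}$. -/

import Mathlib

namespace HarmonicIndex

noncomputable section

/-- A real polynomial in `n` variables is harmonic if its Laplacian
`∂²f/∂x₁² + ⋯ + ∂²f/∂xₙ²` vanishes. -/
def IsHarmonicPoly {n : ℕ} (f : MvPolynomial (Fin n) ℝ) : Prop :=
  ∑ i : Fin n, MvPolynomial.pderiv i (MvPolynomial.pderiv i f) = 0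

/-- A spherical design of harmonic index `t` on the unit sphere of `ℝⁿ`: a finite nonempty
subset of the sphere over which every harmonic homogeneous polynomial of degree `t`
sums to zero. -/
def IsHarmonicIndexDesign {n : ℕ} (t : ℕ) (X : Finset (EuclideanSpace ℝ (Fin n))) : Prop :=
  X.Nonempty ∧ (∀ x ∈ X, x ∈ Metric.sphere (0 : EuclideanSpace ℝ (Fin n)) 1) ∧
    ∀ f : MvPolynomial (Fin n) ℝ, f.IsHomogeneous t → IsHarmonicPoly f →
      ∑ x ∈ X, MvPolynomial.eval (fun i => x i) f = 0

/-- `I(X)`: the set of inner products of pairs of distinct points of `X`. -/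
def innerProducts {n : ℕ} (X : Finset (EuclideanSpace ℝ (Fin n))) : Set ℝ :=
  {a | ∃ x ∈ X, ∃ y ∈ X, x ≠ y ∧ inner ℝ x y = a}

/-- The Gegenbauer polynomial `C_t^lam`, as a function on `ℝ`. For `lam ≠ 0` it is the coefficient
of `r ^ t` in the expansion of `(1 - 2xr + r²)^(-lam)` in powers of `r`, that is, the `t`-th Taylor
coefficient at `r = 0`; for `lam = 0` it is the Chebyshev polynomial of the first kind. -/
def gegenbauer (lam : ℝ) (t : ℕ) (x : ℝ) : ℝ :=
  if lam = 0 then (Polynomial.Chebyshev.T ℝ (t : ℤ)).eval x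
  else iteratedDeriv t (fun r : ℝ => (1 - 2 * x * r + r ^ 2) ^ (-lam)) 0 / (t.factorial : ℝ)

/-- The number `binom (n+t-1) t - binom (n+t-3) (t-2)`; the second binomial coefficient is
`0` when `t < 2`. -/
def harmDim (n t : ℕ) : ℝ :=
  ((n + t - 1).choose t : ℝ) - (if 2 ≤ t then ((n + t - 3).choose (t - 2) : ℝ) else 0)

/-- `Q_{n,t}`: the multiple of the Gegenbauer polynomial `C_t^{(n-2)/2}` whose value at `1` is
`binom (n+t-1) t - binom (n+t-3) (t-2)`. -/
def Q (n t : ℕ) (x : ℝ) : ℝ :=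
  harmDim n t / gegenbauer (((n : ℝ) - 2) / 2) t 1 * gegenbauer (((n : ℝ) - 2) / 2) t x

/-- `c_{n,t} = - min_{-1 ≤ x ≤ 1} Q_{n,t}(x)`. (The infimum is a minimum, as `Q n t` is a
polynomial function and `[-1,1]` is compact.) -/
def c (n t : ℕ) : ℝ := - sInf (Q n t '' Set.Icc (-1) 1)

/-- `b_{n,t}`, the Fisher type lower bound. -/
def b (n t : ℕ) : ℝ := 1 + 1 / c n t * harmDim n t

end

end HarmonicIndex

/-!
The Gegenbauer polynomial of degree 4 for the sphere `S^{n-1}` is a positive multiple of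
`p(a) = (n+2)(n+4) a⁴ - 6(n+2) a² + 3`. Completing the square,
`p(a) = (n+2)(n+4) (a² - 3/(n+4))² - 6(n+1)/(n+4)`, so the minimum on `[-1,1]` is attained
exactly at `a = ±√(3/(n+4))`; together with `p(1) = n² - 1` this gives `b_{n,4}`.

For a unit vector `x` the zonal polynomial
`Z_x(y) = (n+2)(n+4) ⟨x,y⟩⁴ - 6(n+2) |y|²⟨x,y⟩² + 3|y|⁴` is harmonic (`zonal_isHarmonicPoly`) and
equals `p(⟨x,y⟩)` on the sphere (`eval_zonal`). If `X` is a design, `∑_{y ∈ X} p(⟨x,y⟩) = 0` for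
each `x ∈ X`. The term `y = x` is `p(1)`, and each of the `b_{n,4} - 1` others is at least the
minimum of `p`; the cardinality makes the sum of these lower bounds zero, so each other term
attains the minimum.

Conversely, if all the inner products minimise `p`, then `∑_{y ∈ X} p(⟨x,y⟩) = 0` for each
`x ∈ X`. The Fischer inner product `⟪f,g⟫ = ∑_α α! f_α g_α`, for which multiplication by `X_i` is
adjoint to `∂_i`, has the reproducing property `⟪Z_x,g⟫ = 24 (n+2)(n+4) g(x)` for harmonic `g`
homogeneous of degree 4 (`fischer_zonal`). With `F = ∑_{x ∈ X} Z_x` this yields `⟪F,F⟫ = 0`,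
hence `F = 0` by definiteness, hence `∑_{x ∈ X} g(x) = 0` for all such `g`.
-/

namespace HarmonicIndex

open MvPolynomial

/-! ### The Fischer inner product -/

section Fischer

variable {σ : Type*} [Fintype σ]

/-- The Fischer inner product `∑_α α! f_α g_α` of real polynomials, as a bilinear form; it is
determined by its values on monomials in the first argument. -/
noncomputable def fischer : MvPolynomial σ ℝ →ₗ[ℝ] MvPolynomial σ ℝ →ₗ[ℝ] ℝ :=
  (basisMonomials σ ℝ).constr ℝ fun α => ((∏ i, (α i).factorial : ℕ) : ℝ) • lcoeff ℝ α

theorem fischer_monomial (α : σ →₀ ℕ) (a : ℝ) (g : MvPolynomial σ ℝ) :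
    fischer (monomial α a) g = a * ((∏ i, (α i).factorial : ℕ) : ℝ) * coeff α g := by
  have h : monomial α a = a • basisMonomials σ ℝ α := by
    simp [smul_monomial]
  rw [h, fischer, map_smul, Module.Basis.constr_basis]
  simp [mul_assoc]

theorem fischer_self (f : MvPolynomial σ ℝ) :
    fischer f f = ∑ α ∈ f.support, ((∏ i, (α i).factorial : ℕ) : ℝ) * coeff α f ^ 2 := by
  conv_lhs => enter [1]; rw [← support_sum_monomial_coeff f]
  rw [map_sum, LinearMap.sum_apply]
  refine Finset.sum_congr rfl fun α _ => ?_
  rw [fischer_monomial]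
  ring

theorem eq_zero_of_fischer_self_eq_zero {f : MvPolynomial σ ℝ} (h : fischer f f = 0) : f = 0 := by
  rw [fischer_self, Finset.sum_eq_zero_iff_of_nonneg fun α _ => by positivity] at h
  ext α
  by_contra hα
  rw [coeff_zero] at hα
  have h1 := h α (mem_support_iff.2 hα)
  have h2 : (0 : ℝ) < ((∏ i, (α i).factorial : ℕ) : ℝ) :=
    Nat.cast_pos.2 (Finset.prod_pos fun i _ => Nat.factorial_pos _)
  have h3 := (mul_eq_zero.1 h1).resolve_left h2.ne'
  exact hα (pow_eq_zero_iff two_ne_zero |>.1 h3)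

theorem fischer_X_mul (i : σ) (h g : MvPolynomial σ ℝ) :
    fischer (X i * h) g = fischer h (pderiv i g) := by
  classical
  induction h using MvPolynomial.induction_on' with
  | monomial α a =>
    have hX : X i * monomial α a = monomial (α + Finsupp.single i 1) a := by
      rw [X, monomial_mul, one_mul, add_comm]
    have hfac : ∏ j, ((α + Finsupp.single i 1 : σ →₀ ℕ) j).factorial
        = (α i + 1) * ∏ j, (α j).factorial := by
      rw [← Finset.mul_prod_erase _ _ (Finset.mem_univ i),
        ← Finset.mul_prod_erase Finset.univ (fun j => (α j).factorial) (Finset.mem_univ i),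
        ← mul_assoc]
      congr 1
      · simp [Nat.factorial_succ]
      · refine Finset.prod_congr rfl fun j hj => ?_
        simp [(Finset.ne_of_mem_erase hj).symm]
    rw [hX, fischer_monomial, fischer_monomial, coeff_pderiv, hfac]
    push_cast
    ring
  | add p q hp hq => rw [mul_add, map_add, map_add, LinearMap.add_apply, LinearMap.add_apply, hp, hq]

/-- The linear form `y ↦ ⟨x, y⟩`. -/
noncomputable def linForm (x : σ → ℝ) : MvPolynomial σ ℝ := ∑ i, C (x i) * X i

/-- The squared Euclidean norm `y ↦ |y|²`. -/
noncomputable def normSqPoly : MvPolynomial σ ℝ := ∑ i, X i ^ 2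

theorem isHomogeneous_linForm (x : σ → ℝ) : (linForm x).IsHomogeneous 1 :=
  IsHomogeneous.sum _ _ _ fun i _ => by
    simpa using (isHomogeneous_C σ (x i)).mul (isHomogeneous_X ℝ i)

theorem isHomogeneous_normSqPoly : (normSqPoly : MvPolynomial σ ℝ).IsHomogeneous 2 :=
  IsHomogeneous.sum _ _ _ fun i _ => by
    simpa using (isHomogeneous_X ℝ i).pow 2

theorem fischer_linForm_mul (x : σ → ℝ) (h g : MvPolynomial σ ℝ) :
    fischer (linForm x * h) g = fischer h (∑ i, C (x i) * pderiv i g) := by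
  rw [linForm, Finset.sum_mul, map_sum, map_sum, LinearMap.sum_apply]
  refine Finset.sum_congr rfl fun i _ => ?_
  rw [C_mul', C_mul', smul_mul_assoc, map_smul, map_smul, LinearMap.smul_apply, fischer_X_mul]

theorem fischer_normSqPoly_mul (h g : MvPolynomial σ ℝ) :
    fischer (normSqPoly * h) g = fischer h (∑ i, pderiv i (pderiv i g)) := by
  rw [normSqPoly, Finset.sum_mul, map_sum, map_sum, LinearMap.sum_apply]
  refine Finset.sum_congr rfl fun i _ => ?_
  rw [pow_two, mul_assoc, fischer_X_mul, fischer_X_mul]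

/-- Powers of linear forms reproduce point evaluation: this iterates the adjointness of `⟨x, ·⟩`
and the derivative along `x`, evaluated by Euler's identity. -/
theorem fischer_linForm_pow (x : σ → ℝ) (k : ℕ) {g : MvPolynomial σ ℝ} (hg : g.IsHomogeneous k) :
    fischer (linForm x ^ k) g = k.factorial * eval x g := by
  induction k generalizing g with
  | zero =>
    have h0 : g = C (coeff 0 g) :=
      totalDegree_eq_zero_iff_eq_C.1 ((totalDegree_zero_iff_isHomogeneous σ).2 hg)
    rw [h0, pow_zero, ← C_1, ← monomial_zero', fischer_monomial]
    simp
  | succ k ih =>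
    have hd : (∑ i, C (x i) * pderiv i g).IsHomogeneous k :=
      IsHomogeneous.sum _ _ _ fun i _ => by
        simpa using (isHomogeneous_C σ (x i)).mul (hg.pderiv (i := i))
    have he := congrArg (eval x) hg.sum_X_mul_pderiv
    simp only [map_sum, map_mul, eval_X, map_nsmul] at he
    rw [pow_succ', fischer_linForm_mul, ih hd]
    simp only [map_sum, map_mul, eval_C, he, Nat.factorial_succ, nsmul_eq_mul]
    push_cast
    ring

end Fischer

/-! ### Zonal harmonics of degree 4 -/

variable {n : ℕ}

/-- The multiple `(n+2)(n+4) a⁴ - 6(n+2) a² + 3` of the Gegenbauer polynomial of degree 4 with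
parameter `(n-2)/2`. -/
def quarticGegenbauer (n : ℕ) (a : ℝ) : ℝ := (n + 2) * (n + 4) * a ^ 4 - 6 * (n + 2) * a ^ 2 + 3

/-- The homogeneous polynomial of degree 4 that restricts to `quarticGegenbauer n ⟨x, ·⟩` on the
unit sphere. -/
noncomputable def zonal (x : Fin n → ℝ) : MvPolynomial (Fin n) ℝ :=
  (((n + 2) * (n + 4) : ℕ) : MvPolynomial (Fin n) ℝ) * linForm x ^ 4
    - ((6 * (n + 2) : ℕ) : MvPolynomial (Fin n) ℝ) * (normSqPoly * linForm x ^ 2) + 3 * normSqPoly ^ 2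

theorem isHomogeneous_zonal (x : Fin n → ℝ) : (zonal x).IsHomogeneous 4 := by
  have hN := isHomogeneous_normSqPoly (σ := Fin n)
  have hL := isHomogeneous_linForm x
  have hc (m : ℕ) {f : MvPolynomial (Fin n) ℝ} (hf : f.IsHomogeneous 4) :
      ((m : MvPolynomial (Fin n) ℝ) * f).IsHomogeneous 4 := by
    have := (isHomogeneous_C (Fin n) (m : ℝ)).mul hf
    simpa using this
  refine ((hc _ ?_).sub (hc _ ?_)).add (hc 3 ?_)
  · simpa using hL.pow 4
  · simpa using hN.mul (hL.pow 2)
  · simpa using hN.pow 2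

theorem pderiv_linForm (x : Fin n → ℝ) (i : Fin n) : pderiv i (linForm x) = C (x i) := by
  simp [linForm, pderiv_X, Pi.single_apply]

theorem pderiv_normSqPoly (i : Fin n) :
    pderiv i (normSqPoly : MvPolynomial (Fin n) ℝ) = 2 * X i := by
  simp [normSqPoly, pderiv_X, Pi.single_apply]

theorem zonal_isHarmonicPoly {x : Fin n → ℝ} (hx : ∑ i, x i ^ 2 = 1) :
    IsHarmonicPoly (zonal x) := by
  set L := linForm x with hL
  set N : MvPolynomial (Fin n) ℝ := normSqPoly with hN
  have key (i : Fin n) : pderiv i (pderiv i (zonal x)) =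
      (12 * (((n : MvPolynomial (Fin n) ℝ) + 2) * ((n : MvPolynomial (Fin n) ℝ) + 4)) * L ^ 2
          - 12 * ((n : MvPolynomial (Fin n) ℝ) + 2) * N) * C (x i) ^ 2
        - 48 * ((n : MvPolynomial (Fin n) ℝ) + 2) * L * (C (x i) * X i) + 24 * X i ^ 2
        + (12 * N - 12 * ((n : MvPolynomial (Fin n) ℝ) + 2) * L ^ 2) := by
    have h1 : pderiv i L = C (x i) := pderiv_linForm x i
    have h2 : pderiv i N = 2 * X i := pderiv_normSqPoly i
    have h3 (m : ℕ) [m.AtLeastTwo] :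
        pderiv i (OfNat.ofNat m : MvPolynomial (Fin n) ℝ) = 0 :=
      Derivation.map_natCast (pderiv i) m
    simp only [zonal, ← hL, ← hN, map_add, map_sub, pderiv_mul, pderiv_pow, h1, h2, h3,
      Derivation.map_natCast, pderiv_C, pderiv_X_self, map_zero]
    push_cast
    ring
  have hx' : ∑ i, (C (x i) : MvPolynomial (Fin n) ℝ) ^ 2 = 1 := by
    simp only [← map_pow, ← map_sum, hx, C_1]
  change ∑ i, pderiv i (pderiv i (zonal x)) = 0
  rw [Finset.sum_congr rfl fun i _ => key i]
  simp only [Finset.sum_add_distrib, Finset.sum_sub_distrib, ← Finset.mul_sum]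
  rw [hx', show ∑ i, C (x i) * X i = L from rfl,
    show ∑ i, (X i : MvPolynomial (Fin n) ℝ) ^ 2 = N from rfl]
  simp only [Finset.sum_const, Finset.card_univ, Fintype.card_fin, nsmul_eq_mul]
  ring

/-- The terms of `zonal x` divisible by `|y|²` pair to zero with harmonic polynomials. -/
theorem fischer_zonal (x : Fin n → ℝ) {g : MvPolynomial (Fin n) ℝ} (hg : g.IsHomogeneous 4)
    (hh : IsHarmonicPoly g) : fischer (zonal x) g = 24 * ((n + 2) * (n + 4)) * eval x g := by
  have hz : zonal x = (((n + 2) * (n + 4) : ℕ) : ℝ) • linForm x ^ 4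
      + normSqPoly * (3 * normSqPoly - ((6 * (n + 2) : ℕ) : MvPolynomial (Fin n) ℝ) * linForm x ^ 2) := by
    rw [zonal, smul_eq_C_mul, map_natCast]
    ring
  rw [hz, map_add, LinearMap.add_apply, map_smul, LinearMap.smul_apply, fischer_normSqPoly_mul,
    show ∑ i, pderiv i (pderiv i g) = 0 from hh, map_zero, fischer_linForm_pow x 4 hg]
  simp [Nat.factorial]
  ring

theorem sum_sq_eq_one {x : EuclideanSpace ℝ (Fin n)} (hx : x ∈ Metric.sphere 0 1) :
    ∑ i, x i ^ 2 = 1 := by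
  rw [← EuclideanSpace.real_norm_sq_eq, mem_sphere_zero_iff_norm.1 hx, one_pow]

theorem eval_zonal (x : EuclideanSpace ℝ (Fin n)) {y : EuclideanSpace ℝ (Fin n)}
    (hy : y ∈ Metric.sphere 0 1) :
    eval (fun i => y i) (zonal fun i => x i) = quarticGegenbauer n (inner ℝ x y) := by
  have h1 : eval (fun i => y i) (linForm fun i => x i) = inner ℝ x y := by
    simp [linForm, PiLp.inner_apply, mul_comm]
  have h2 : eval (fun i => y i) (normSqPoly : MvPolynomial (Fin n) ℝ) = 1 := by
    simp [normSqPoly, sum_sq_eq_one hy]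
  simp [zonal, quarticGegenbauer, h1, h2]

/-- A set whose zonal sums over itself vanish is a design: the sum `F` of its zonal polynomials
satisfies `⟪F, F⟫ = 0`. -/
theorem isHarmonicIndexDesign_of_sum_eq_zero {X : Finset (EuclideanSpace ℝ (Fin n))}
    (hne : X.Nonempty) (hX : ∀ x ∈ X, x ∈ Metric.sphere (0 : EuclideanSpace ℝ (Fin n)) 1)
    (h : ∀ x ∈ X, ∑ y ∈ X, quarticGegenbauer n (inner ℝ x y) = 0) :
    IsHarmonicIndexDesign 4 X := by
  refine ⟨hne, hX, fun f hf hh => ?_⟩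
  set F : MvPolynomial (Fin n) ℝ := ∑ x ∈ X, zonal fun i => x i with hF
  have hFhom : F.IsHomogeneous 4 := IsHomogeneous.sum _ _ _ fun x _ => isHomogeneous_zonal _
  have hFharm : IsHarmonicPoly F := by
    simp only [IsHarmonicPoly, hF, map_sum]
    rw [Finset.sum_comm]
    exact Finset.sum_eq_zero fun x hx => zonal_isHarmonicPoly (sum_sq_eq_one (hX x hx))
  have hpair {g : MvPolynomial (Fin n) ℝ} (hg : g.IsHomogeneous 4) (hgh : IsHarmonicPoly g) :
      fischer F g = 24 * ((n + 2) * (n + 4)) * ∑ x ∈ X, eval (fun i => x i) g := by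
    rw [hF, map_sum, LinearMap.sum_apply, Finset.mul_sum]
    exact Finset.sum_congr rfl fun x _ => fischer_zonal _ hg hgh
  have hFF : fischer F F = 0 := by
    rw [hpair hFhom hFharm]
    simp only [hF, map_sum]
    rw [Finset.sum_comm, Finset.sum_eq_zero, mul_zero]
    intro x hx
    rw [← h x hx]
    exact Finset.sum_congr rfl fun y hy => eval_zonal x (hX y hy)
  have h0 := hpair hf hh
  rw [eq_zero_of_fischer_self_eq_zero hFF, map_zero, LinearMap.zero_apply] at h0
  exact (mul_eq_zero.1 h0.symm).resolve_left (by positivity)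

/-! ### The Gegenbauer polynomial of degree 4 and the Fisher type bound -/

theorem quarticGegenbauer_eq (n : ℕ) (a : ℝ) : quarticGegenbauer n a =
    (n + 2) * (n + 4) * (a ^ 2 - 3 / (n + 4)) ^ 2 - 6 * (n + 1) / (n + 4) := by
  have : (n : ℝ) + 4 ≠ 0 := by positivity
  rw [quarticGegenbauer]
  field_simp
  ring

theorem quarticGegenbauer_one (n : ℕ) : quarticGegenbauer n 1 = (n : ℝ) ^ 2 - 1 := by
  rw [quarticGegenbauer]
  ring

theorem iteratedDeriv_four_eq {f f₁ f₂ f₃ f₄ : ℝ → ℝ} {U : Set ℝ} (hU : IsOpen U)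
    (h₁ : ∀ r ∈ U, HasDerivAt f (f₁ r) r) (h₂ : ∀ r ∈ U, HasDerivAt f₁ (f₂ r) r)
    (h₃ : ∀ r ∈ U, HasDerivAt f₂ (f₃ r) r) (h₄ : ∀ r ∈ U, HasDerivAt f₃ (f₄ r) r) :
    Set.EqOn (iteratedDeriv 4 f) f₄ U := by
  have step {k : ℕ} {g g' : ℝ → ℝ} (hk : Set.EqOn (iteratedDeriv k f) g U)
      (hg : ∀ r ∈ U, HasDerivAt g (g' r) r) : Set.EqOn (iteratedDeriv (k + 1) f) g' U := by
    intro r hr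
    rw [iteratedDeriv_succ, ← (hg r hr).deriv]
    exact (hk.eventuallyEq_of_mem (hU.mem_nhds hr)).deriv_eq
  exact step (step (step (step (k := 0) (by simp [Set.eqOn_refl]) h₁) h₂) h₃) h₄

/-- The fourth derivative of `(1 - 2xr + r²)^a` at `r = 0`. -/
theorem iteratedDeriv_four_generating (a x : ℝ) :
    iteratedDeriv 4 (fun r : ℝ => (1 - 2 * x * r + r ^ 2) ^ a) 0 =
      12 * a * (a - 1) + 48 * a * (a - 1) * (a - 2) * x ^ 2
        + 16 * a * (a - 1) * (a - 2) * (a - 3) * x ^ 4 := by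
  set u : ℝ → ℝ := fun r => 1 - 2 * x * r + r ^ 2 with hu
  have huc : Continuous u := by fun_prop
  have hv (r : ℝ) : HasDerivAt (fun r => r - x) 1 r := (hasDerivAt_id r).sub_const x
  have hpow (e r : ℝ) (hr : r ∈ {r | 0 < u r}) :
      HasDerivAt (fun r => u r ^ e) (2 * e * (r - x) * u r ^ (e - 1)) r := by
    have h1 : HasDerivAt u (2 * (r - x)) r := by
      have := (((hasDerivAt_id r).const_mul (2 * x)).const_sub 1).add (hasDerivAt_pow 2 r)
      convert! this using 1
      simp
      ring
    have h2 := h1.rpow_const (p := e) (Or.inl (ne_of_gt hr))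
    convert! h2 using 1
    ring
  have h := iteratedDeriv_four_eq (isOpen_lt continuous_const huc)
    (f₁ := fun r => 2 * a * ((r - x) * u r ^ (a - 1)))
    (f₂ := fun r => 2 * a * u r ^ (a - 1)
      + 4 * a * (a - 1) * ((r - x) ^ 2 * u r ^ (a - 1 - 1)))
    (f₃ := fun r => 12 * a * (a - 1) * ((r - x) * u r ^ (a - 1 - 1))
      + 8 * a * (a - 1) * (a - 2) * ((r - x) ^ 3 * u r ^ (a - 1 - 1 - 1)))
    (f₄ := fun r => 12 * a * (a - 1) * u r ^ (a - 1 - 1)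
      + 48 * a * (a - 1) * (a - 2) * ((r - x) ^ 2 * u r ^ (a - 1 - 1 - 1))
      + 16 * a * (a - 1) * (a - 2) * (a - 3) * ((r - x) ^ 4 * u r ^ (a - 1 - 1 - 1 - 1)))
    (fun r hr => (hpow a r hr).congr_deriv (by ring))
    (fun r hr => (((hv r).mul (hpow (a - 1) r hr)).const_mul (2 * a)).congr_deriv (by ring))
    (fun r hr => (((hpow (a - 1) r hr).const_mul (2 * a)).add
      ((((hv r).pow 2).mul (hpow (a - 1 - 1) r hr)).const_mul (4 * a * (a - 1)))).congr_deriv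
      (by push_cast; simp only [Pi.pow_apply]; ring))
    (fun r hr => ((((hv r).mul (hpow (a - 1 - 1) r hr)).const_mul (12 * a * (a - 1))).add
      ((((hv r).pow 3).mul (hpow (a - 1 - 1 - 1) r hr)).const_mul
        (8 * a * (a - 1) * (a - 2)))).congr_deriv
      (by push_cast; simp only [Pi.pow_apply]; ring))
  rw [h (by simp [hu] : (0 : ℝ) ∈ {r | 0 < u r})]
  simp [hu, Even.neg_pow (by decide : Even 4)]

/-- For `n = 2` the Gegenbauer polynomial is `T_4`, and the constant is `1/3`; otherwise the
constant is `λ(λ+1)/6` with `λ = (n-2)/2`. -/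
theorem exists_gegenbauer_eq (hn : 2 ≤ n) :
    ∃ k : ℝ, k ≠ 0 ∧ ∀ x, gegenbauer (((n : ℝ) - 2) / 2) 4 x = k * quarticGegenbauer n x := by
  rcases hn.eq_or_lt with rfl | hn
  · refine ⟨1 / 3, by norm_num, fun x => ?_⟩
    have hT : Polynomial.Chebyshev.T ℝ 4 = 8 * Polynomial.X ^ 4 - 8 * Polynomial.X ^ 2 + 1 := by
      have h3 := Polynomial.Chebyshev.T_add_two ℝ 1
      have h4 := Polynomial.Chebyshev.T_add_two ℝ 2
      norm_num [Polynomial.Chebyshev.T_two] at h3 h4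
      rw [h4, h3]
      ring
    simp [gegenbauer, quarticGegenbauer, hT]
    ring
  · have hn' : (2 : ℝ) < n := by exact_mod_cast hn
    refine ⟨((n : ℝ) - 2) / 2 * (((n : ℝ) - 2) / 2 + 1) / 6, ?_, fun x => ?_⟩
    · have : 0 < ((n : ℝ) - 2) / 2 := by linarith
      positivity
    · rw [gegenbauer, if_neg (by linarith : ¬ ((n : ℝ) - 2) / 2 = 0), iteratedDeriv_four_generating,
        quarticGegenbauer]
      simp only [Nat.factorial]
      push_cast
      ring

theorem harmDim_four_pos (hn : 2 ≤ n) : 0 < harmDim n 4 := by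
  have h1 : n + 4 - 1 = n + 1 + 1 + 1 := by omega
  have h2 : n + 4 - 3 = n + 1 := by omega
  have h3 : 0 < (n + 1).choose 3 := Nat.choose_pos (by omega)
  rw [harmDim, if_pos (by norm_num), sub_pos, Nat.cast_lt, h1, h2, show 4 - 2 = 2 from rfl]
  simp only [Nat.choose_succ_succ' (n + 1 + 1) 3, Nat.choose_succ_succ' (n + 1) 3,
    Nat.choose_succ_succ' (n + 1) 2]
  omega

theorem Q_four_eq (hn : 2 ≤ n) (x : ℝ) :
    Q n 4 x = harmDim n 4 / ((n : ℝ) ^ 2 - 1) * quarticGegenbauer n x := by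
  obtain ⟨k, hk, h⟩ := exists_gegenbauer_eq hn
  rw [Q, h, h, quarticGegenbauer_one, mul_comm k (_ - 1), ← div_div]
  field_simp

theorem c_four_eq (hn : 2 ≤ n) :
    c n 4 = harmDim n 4 / ((n : ℝ) ^ 2 - 1) * (6 * (n + 1) / (n + 4)) := by
  have hn' : (2 : ℝ) ≤ n := by exact_mod_cast hn
  have hk : 0 < harmDim n 4 / ((n : ℝ) ^ 2 - 1) := div_pos (harmDim_four_pos hn) (by nlinarith)
  have hq : (0 : ℝ) ≤ 3 / ((n : ℝ) + 4) := by positivity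
  have hleast : IsLeast (Q n 4 '' Set.Icc (-1) 1)
      (harmDim n 4 / ((n : ℝ) ^ 2 - 1) * -(6 * (n + 1) / (n + 4))) := by
    constructor
    · refine ⟨Real.sqrt (3 / (n + 4)), ⟨by linarith [Real.sqrt_nonneg (3 / ((n : ℝ) + 4))], ?_⟩, ?_⟩
      · refine Real.sqrt_le_one.2 ((div_le_one (by linarith)).2 (by linarith))
      · rw [Q_four_eq hn, quarticGegenbauer_eq, Real.sq_sqrt hq]
        ring
    · rintro _ ⟨x, -, rfl⟩
      rw [Q_four_eq hn, quarticGegenbauer_eq]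
      refine mul_le_mul_of_nonneg_left ?_ hk.le
      have : 0 ≤ ((n : ℝ) + 2) * (n + 4) * (x ^ 2 - 3 / (n + 4)) ^ 2 := by positivity
      linarith
  rw [c, hleast.csInf_eq]
  ring

theorem b_four_eq (hn : 2 ≤ n) : b n 4 = ((n : ℝ) + 1) * ((n : ℝ) + 2) / 6 := by
  have hn' : (2 : ℝ) ≤ n := by exact_mod_cast hn
  have hd := (harmDim_four_pos hn).ne'
  have h1 : (n : ℝ) ^ 2 - 1 ≠ 0 := by nlinarith
  rw [b, c_four_eq hn]
  field_simp
  ring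

theorem exists_int_b_four_iff (hn : 2 ≤ n) : (∃ m : ℤ, b n 4 = (m : ℝ)) ↔ ¬ 3 ∣ n := by
  have h6 : (6 ∣ (n + 1) * (n + 2)) ↔ ¬ 3 ∣ n := by
    have h2 : 2 ∣ (n + 1) * (n + 2) := (Nat.even_mul_succ_self (n + 1)).two_dvd
    have h3 : 3 ∣ (n + 1) * (n + 2) ↔ ¬ 3 ∣ n := by
      rw [Nat.prime_three.dvd_mul]
      omega
    rw [← h3]
    generalize (n + 1) * (n + 2) = m at h2
    omega
  rw [b_four_eq hn, ← h6]
  constructor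
  · rintro ⟨m, hm⟩
    have : (((n + 1) * (n + 2) : ℕ) : ℤ) = (6 : ℕ) * m := by
      have : ((n : ℝ) + 1) * (n + 2) = 6 * m := by linarith
      exact_mod_cast this
    exact Int.natCast_dvd_natCast.1 ⟨m, this⟩
  · rintro ⟨m, hm⟩
    refine ⟨m, ?_⟩
    have : ((n : ℝ) + 1) * (n + 2) = 6 * m := by exact_mod_cast hm
    rw [this]
    push_cast
    ring

/-! ### Tightness -/

/-- For a set of size `b_{n,4}`, the zonal sum at `x` is a sum of squares that vanishes exactly
when the inner products with `x` are `±√(3/(n+4))`. -/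
theorem sum_quarticGegenbauer_eq {X : Finset (EuclideanSpace ℝ (Fin n))}
    (hX : ∀ x ∈ X, x ∈ Metric.sphere (0 : EuclideanSpace ℝ (Fin n)) 1)
    (hcard : (X.card : ℝ) = ((n : ℝ) + 1) * ((n : ℝ) + 2) / 6)
    {x : EuclideanSpace ℝ (Fin n)} (hx : x ∈ X) :
    ∑ y ∈ X, quarticGegenbauer n (inner ℝ x y) =
      ∑ y ∈ X.erase x, (n + 2) * (n + 4) * ((inner ℝ x y) ^ 2 - 3 / ((n : ℝ) + 4)) ^ 2 := by
  have hxx : inner ℝ x x = (1 : ℝ) := by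
    rw [real_inner_self_eq_norm_sq, mem_sphere_zero_iff_norm.1 (hX x hx), one_pow]
  have hc : ((X.erase x).card : ℝ) = X.card - 1 := by
    rw [← Finset.card_erase_add_one hx]
    push_cast
    ring
  rw [← Finset.add_sum_erase _ _ hx, hxx, quarticGegenbauer_one]
  simp only [quarticGegenbauer_eq, Finset.sum_sub_distrib, Finset.sum_const, nsmul_eq_mul, hc, hcard]
  field_simp
  ring

theorem sq_eq_three_div_iff (n : ℕ) (a : ℝ) : a ^ 2 = 3 / ((n : ℝ) + 4) ↔
    a ∈ ({Real.sqrt (3 / ((n : ℝ) + 4)), -Real.sqrt (3 / ((n : ℝ) + 4))} : Set ℝ) := by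
  have hq : (0 : ℝ) ≤ 3 / ((n : ℝ) + 4) := by positivity
  rw [Set.mem_insert_iff, Set.mem_singleton_iff, ← sq_eq_sq_iff_eq_or_eq_neg, Real.sq_sqrt hq]

theorem isHarmonicIndexDesign_four_iff {X : Finset (EuclideanSpace ℝ (Fin n))}
    (hX : ∀ x ∈ X, x ∈ Metric.sphere (0 : EuclideanSpace ℝ (Fin n)) 1)
    (hcard : (X.card : ℝ) = ((n : ℝ) + 1) * ((n : ℝ) + 2) / 6) :
    IsHarmonicIndexDesign 4 X ↔ innerProducts X ⊆
      {Real.sqrt (3 / ((n : ℝ) + 4)), -Real.sqrt (3 / ((n : ℝ) + 4))} := by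
  constructor
  · rintro ⟨-, -, hdes⟩ _ ⟨x, hx, y, hy, hxy, rfl⟩
    have h := hdes _ (isHomogeneous_zonal fun i => x i)
      (zonal_isHarmonicPoly (sum_sq_eq_one (hX x hx)))
    rw [Finset.sum_congr rfl fun z hz => eval_zonal x (hX z hz),
      sum_quarticGegenbauer_eq hX hcard hx,
      Finset.sum_eq_zero_iff_of_nonneg fun z _ => by positivity] at h
    have h' := (mul_eq_zero.1 (h y (Finset.mem_erase.2 ⟨hxy.symm, hy⟩))).resolve_left
      (by positivity)
    exact (sq_eq_three_div_iff n _).1 (sub_eq_zero.1 (pow_eq_zero_iff two_ne_zero |>.1 h'))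
  · intro h
    have hne : X.Nonempty := by
      rw [← Finset.card_pos, ← Nat.cast_pos (α := ℝ), hcard]
      positivity
    refine isHarmonicIndexDesign_of_sum_eq_zero hne hX fun x hx => ?_
    rw [sum_quarticGegenbauer_eq hX hcard hx]
    refine Finset.sum_eq_zero fun y hy => ?_
    obtain ⟨hyx, hy⟩ := Finset.mem_erase.1 hy
    rw [(sq_eq_three_div_iff n _).2 (h ⟨x, hx, y, hy, hyx.symm, rfl⟩)]
    ring

end HarmonicIndex

theorem mainTheorem5 (n : ℕ) (hn : 2 ≤ n) :
    HarmonicIndex.b n 4 = ((n : ℝ) + 1) * ((n : ℝ) + 2) / 6 ∧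
    ((∃ m : ℤ, HarmonicIndex.b n 4 = (m : ℝ)) ↔ ¬ 3 ∣ n) ∧
    (¬ 3 ∣ n → ∀ X : Finset (EuclideanSpace ℝ (Fin n)),
      (∀ x ∈ X, x ∈ Metric.sphere (0 : EuclideanSpace ℝ (Fin n)) 1) →
      (X.card : ℝ) = HarmonicIndex.b n 4 →
        (HarmonicIndex.IsHarmonicIndexDesign 4 X ↔
          HarmonicIndex.innerProducts X ⊆
            {Real.sqrt (3 / ((n : ℝ) + 4)), -Real.sqrt (3 / ((n : ℝ) + 4))})) := by
  refine ⟨HarmonicIndex.b_four_eq hn, HarmonicIndex.exists_int_b_four_iff hn, fun _ X hX hcard => ?_⟩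
  exact HarmonicIndex.isHarmonicIndexDesign_four_iff hX (hcard.trans (HarmonicIndex.b_four_eq hn))
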